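/- Let $\mathbb{F}\in\{\mathbb{R},\mathbb{C}\}$, $E,A,D\in\mathbb{F}^{n,n}$, $\tau>0$, $M\in\mathbb{N}$ with $M\ge 1$, let $f:[0,M\tau]\to\mathbb{F}^n$ be infinitely often continuously differentiable, and suppose that the pencil $(E,A)$ is regular, i.e. $\det(\mu E-A)\neq 0$ for some $\mu\in\mathbb{F}$. Consider the delay differential-algebraic equation (DDAE) $$E\dot x(t)=Ax(t)+Dx(t-\tau)+f(t),\qquad t\in[0,M\tau].$$ A solution of a DAE $E\dot y=Ay+q$ on $[0,T]$ is a function $y\in C^1([0,T],\mathbb{F}^n)$ satisfying the equation pointwise, and $y_0\in\mathbb{F}^n$ is a consistent initial value if there is a solution with $y(0)=y_0$. *De-smoothing type.* For $\tilde f\in C^\infty([0,M\tau],\mathbb{F}^n)$ and $\phi\in C^\infty([-\tau,0],\mathbb{F}^n)$ put $x_{[0]}(t)=\phi(t-\tau)$ for $t\in[0,\tau]$, and for $i=1,\dots,M$ let $x_{[i]}$ be the solution, as far as it exists, of $$E\dot x_{[i]}(t)=Ax_{[i]}(t)+Dx_{[i-1]}(t)+\tilde f(t+(i-1)\tau),\quad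 t\in[0,\tau],\qquad x_{[i]}(0)=x_{[i-1]}(\tau).$$ Call $\phi$ admissible for $\tilde f$ if $x_{[1]}$ exists. For $i=1,\dots,M$ let $$\ell_i=\min_{\tilde f}\ \min_{\phi\text{ admissible for }\tilde f}\ \sup\{\ell\in\mathbb{N}_0 : x_{[1]},\dots,x_{[i]}\text{ exist and } x_{[i]}^{(k)}(0^+)=x_{[i-1]}^{(k)}(\tau^-)\text{ for all }0\le k\le \ell\},$$ with values in $\{-\infty\}\cup\mathbb{N}_0\cup\{\infty\}$ and $\sup\emptyset=-\infty$. The DDAE is of de-smoothing type if there is $j\in\{2,\dots,M\}$ with $\ell_j=-\infty$ and $\ell_i=0$ for all $1\le i<j$. *Advanced in the sense of Ha and Mehrmann.* A function $\lambda:[0,M\tau]\to\mathbb{F}^n$ is a consistent function parameter if the DAE $E\dot x=Ax+D\lambda+f$ on $[0,M\tau]$ has a consistent initial value. The DDAE is advanced if the least $k\in\mathbb{N}_0$ such that every $\lambda\in C^k([0,M\tau],\mathbb{F}^n)$ is a consistent function parameter satisfies $k\ge 2$. Then: 1. If the DDAE is not advanced, then it is not of de-smoothing type. 2. If $M\geq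 2$ and the DDAE is advanced, then it is of de-smoothing type. -/

import Mathlib

open Set
open scoped ContDiff Matrix

namespace DDAE

variable {𝕜 : Type*} [RCLike 𝕜] {n : ℕ}

/-- The matrix pencil `(E, A)` is regular. -/
def IsRegularPencil (E A : Matrix (Fin n) (Fin n) 𝕜) : Prop :=
  ∃ μ : 𝕜, (μ • E - A).det ≠ 0

/-- `x` is a (classical) solution of the DAE `E ẋ = A x + q` on `[0, T]`: it is continuously
differentiable on `[0, T]` and satisfies the equation pointwise. -/
def IsDAESolution (E A : Matrix (Fin n) (Fin n) 𝕜) (T : ℝ) (q x : ℝ → Fin n → 𝕜) : Prop :=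
  ContDiffOn ℝ 1 x (Icc 0 T) ∧
    ∀ t ∈ Icc 0 T, E *ᵥ derivWithin x (Icc 0 T) t = A *ᵥ x t + q t

/-- The initial value `x₀` is consistent for the DAE `E ẋ = A x + q` on `[0, T]`. -/
def IsConsistentInitialValue (E A : Matrix (Fin n) (Fin n) 𝕜) (T : ℝ) (q : ℝ → Fin n → 𝕜)
    (x₀ : Fin n → 𝕜) : Prop :=
  ∃ x : ℝ → Fin n → 𝕜, IsDAESolution E A T q x ∧ x 0 = x₀

/-! ### Propagation of primary discontinuities -/

/-- The history `φ : [-τ, 0] → 𝕜ⁿ` is admissible: `φ 0` is consistent for the DAE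
`E ẋ(t) = A x(t) + D φ(t - τ) + f(t)` on the first delay interval `[0, τ]`. -/
def IsAdmissible (E A D : Matrix (Fin n) (Fin n) 𝕜) (τ : ℝ) (f φ : ℝ → Fin n → 𝕜) : Prop :=
  IsConsistentInitialValue E A τ (fun t => D *ᵥ φ (t - τ) + f t) (φ 0)

/-- `x 0, …, x i` are the pieces on `[0, τ]` produced by the method of steps: `x 0 = φ(· - τ)`,
and, for `1 ≤ k ≤ i`, `x k` solves `E ẋₖ = A xₖ + D xₖ₋₁ + f(· + (k-1)τ)`, `xₖ(0) = xₖ₋₁(τ)`. -/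
def IsStepSequence (E A D : Matrix (Fin n) (Fin n) 𝕜) (τ : ℝ) (f φ : ℝ → Fin n → 𝕜) (i : ℕ)
    (x : ℕ → ℝ → Fin n → 𝕜) : Prop :=
  (∀ t ∈ Icc 0 τ, x 0 t = φ (t - τ)) ∧
    ∀ k < i,
      IsDAESolution E A τ (fun t => D *ᵥ x k t + f (t + k * τ)) (x (k + 1)) ∧
        x (k + 1) 0 = x k τ

/-- The orders `ℓ` up to which the one-sided derivatives at the `i`-th junction `t = (i-1)τ`
(for `i ≥ 1`) agree, for given data `f`, `φ`. The set is empty if there is no solution up to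
step `i`. -/
def matchingOrders (E A D : Matrix (Fin n) (Fin n) 𝕜) (τ : ℝ) (f φ : ℝ → Fin n → 𝕜) (i : ℕ) :
    Set ℕ :=
  {ℓ | ∃ x : ℕ → ℝ → Fin n → 𝕜, IsStepSequence E A D τ f φ i x ∧
    ∀ k ≤ ℓ, iteratedDerivWithin k (x i) (Icc 0 τ) 0 =
      iteratedDerivWithin k (x (i - 1)) (Icc 0 τ) τ}

/-- The level of the `i`-th primary discontinuity for given data `f`, `φ`. It is `⊥` (that is
`-∞`) if there is no solution up to step `i`, and `⊤` if all derivatives agree. -/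
noncomputable def dataLevel (E A D : Matrix (Fin n) (Fin n) 𝕜) (τ : ℝ) (f φ : ℝ → Fin n → 𝕜)
    (i : ℕ) : WithBot ℕ∞ :=
  sSup ((fun ℓ : ℕ => ((ℓ : ℕ∞) : WithBot ℕ∞)) '' matchingOrders E A D τ f φ i)

/-- The level `ℓᵢ` of the `i`-th primary discontinuity: the worst case of `dataLevel` over all
smooth inhomogeneities `f` on `[0, Mτ]` and all smooth admissible histories `φ` on `[-τ, 0]`. -/
noncomputable def level (E A D : Matrix (Fin n) (Fin n) 𝕜) (τ : ℝ) (M i : ℕ) : WithBot ℕ∞ :=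
  sInf {l | ∃ f φ : ℝ → Fin n → 𝕜,
    ContDiffOn ℝ ∞ f (Icc 0 (M * τ)) ∧ ContDiffOn ℝ ∞ φ (Icc (-τ) 0) ∧
      IsAdmissible E A D τ f φ ∧ l = dataLevel E A D τ f φ i}

/-- The DDAE `E ẋ(t) = A x(t) + D x(t - τ) + f(t)` on `[0, Mτ]` is of de-smoothing type. -/
def IsDeSmoothing (E A D : Matrix (Fin n) (Fin n) 𝕜) (τ : ℝ) (M : ℕ) : Prop :=
  ∃ j : ℕ, 1 < j ∧ j ≤ M ∧ level E A D τ M j = ⊥ ∧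
    ∀ i : ℕ, 1 ≤ i → i < j → level E A D τ M i = 0

/-! ### The classification of Ha and Mehrmann -/

/-- The function parameter `lam` is consistent: the DAE `E ẋ = A x + D lam + f` on `[0, T]`
possesses a consistent initial value. -/
def IsConsistentParameter (E A D : Matrix (Fin n) (Fin n) 𝕜) (T : ℝ) (f lam : ℝ → Fin n → 𝕜) :
    Prop :=
  ∃ x₀ : Fin n → 𝕜, IsConsistentInitialValue E A T (fun t => D *ᵥ lam t + f t) x₀

/-- Smoothness `C^k` on `[0, T]` is sufficient for a function parameter to be consistent. -/
def SmoothnessSuffices (E A D : Matrix (Fin n) (Fin n) 𝕜) (T : ℝ) (f : ℝ → Fin n → 𝕜)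
    (k : ℕ) : Prop :=
  ∀ lam : ℝ → Fin n → 𝕜, ContDiffOn ℝ k lam (Icc 0 T) → IsConsistentParameter E A D T f lam

/-- The DDAE `E ẋ(t) = A x(t) + D x(t - τ) + f(t)` on `[0, T]` is advanced: the minimum
smoothness requirement for a consistent function parameter is `C^k` with some `k ≥ 2`. -/
def IsAdvanced (E A D : Matrix (Fin n) (Fin n) 𝕜) (T : ℝ) (f : ℝ → Fin n → 𝕜) : Prop :=
  ∃ k : ℕ, 2 ≤ k ∧ IsLeast {m : ℕ | SmoothnessSuffices E A D T f m} k

end DDAE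

/-! Regularity gives a Weierstrass form `S * E = P + N`, `S * A = J + Q`, which splits the DAE into
an ODE with free initial value and a nilpotent equation `N w' = w + Q S q`, whose only solution is
`-∑ Nʲ (Q S q)⁽ʲ⁾`. Both properties are decided by whether `N * S * D = 0`. If it vanishes, no
derivative of the delayed term enters the algebraic part: `C¹` parameters suffice, and each step
ends at a consistent value for the next, so no level is `⊥`. If `N S D c ≠ 0`, a `C¹` parameter in
direction `c` that is not twice differentiable has no solution, while `C^k` with `N ^ k = 0`
suffices, so the equation is advanced. With zero history and `f t = E c - t A c`, the first step is
forced to be `t c`; its slope `c` jumps from `0`, and the second step asks for an initial value that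
misses `τ c` by `N S D c`. Hence the equation is de-smoothing with `j = 2`. -/

namespace DDAE

variable {𝕜 : Type*} [RCLike 𝕜] {n : ℕ}

/-! ### Weierstrass form of a regular pencil -/

/-- A coordinate-free Weierstrass form of the pencil `(E, A)`: `P` and `Q` are the complementary
spectral projections, `J` the finite part and `N` the nilpotent part. -/
structure IsWeierstrassForm (E A S P Q J N : Matrix (Fin n) (Fin n) 𝕜) : Prop where
  isUnit : IsUnit S
  mul_left : S * E = P + N
  mul_right : S * A = J + Q
  add_eq_one : P + Q = 1
  P_mul_P : P * P = P
  Q_mul_Q : Q * Q = Q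
  P_mul_Q : P * Q = 0
  Q_mul_P : Q * P = 0
  P_mul_J : P * J = J
  J_mul_P : J * P = J
  Q_mul_N : Q * N = N
  N_mul_Q : N * Q = N
  isNilpotent : IsNilpotent N

open Polynomial in
/-- The Fitting decomposition of a matrix, in terms of projections and the Drazin inverse. -/
theorem exists_drazin (a : Matrix (Fin n) (Fin n) 𝕜) :
    ∃ P Q B : Matrix (Fin n) (Fin n) 𝕜, P + Q = 1 ∧ P * Q = 0 ∧ Q * P = 0 ∧ B * a = P ∧
      B * P = B ∧ P * B = B ∧ Commute a Q ∧ Commute a P ∧ IsNilpotent (Q * a) := by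
  -- The extra factor `X` makes `0` a root even when `a` is invertible, so `k = m + 1` and `X ^ m`
  -- is available for the Drazin inverse.
  have hp : (X * a.charpoly : 𝕜[X]) ≠ 0 := mul_ne_zero X_ne_zero a.charpoly_monic.ne_zero
  obtain ⟨g, hg, hndvd⟩ := exists_eq_pow_rootMultiplicity_mul_and_not_dvd (X * a.charpoly) hp 0
  set k := rootMultiplicity 0 (X * a.charpoly) with hk
  have hk0 : 0 < k := by
    rw [hk, rootMultiplicity_pos hp]; simp
  obtain ⟨m, hm⟩ : ∃ m, k = m + 1 := ⟨k - 1, by omega⟩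
  rw [hm] at hg
  simp only [map_zero, sub_zero] at hg hndvd
  have hcop : IsCoprime (X ^ (m + 1) : 𝕜[X]) g :=
    (((irreducible_X (R := 𝕜)).coprime_iff_not_dvd.2 hndvd)).pow_left
  obtain ⟨u, v, huv⟩ := hcop
  have h0 : ∀ r : 𝕜[X], aeval a (r * (X ^ (m + 1) * g)) = 0 := fun r => by
    rw [← hg, map_mul, map_mul, Matrix.aeval_self_charpoly, mul_zero, mul_zero]
  have hcomm : ∀ p q : 𝕜[X], Commute (aeval a p) (aeval a q) := fun p q => by
    rw [Commute, SemiconjBy, ← map_mul, ← map_mul, mul_comm]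
  have hPQ : aeval a (u * X ^ (m + 1)) * aeval a (v * g) = 0 := by
    rw [← map_mul, ← h0 (u * v)]; congr 1; ring
  have hone : aeval a (u * X ^ (m + 1)) + aeval a (v * g) = 1 := by
    rw [← map_add, huv, map_one]
  have hPP : aeval a (u * X ^ (m + 1)) * aeval a (u * X ^ (m + 1)) =
      aeval a (u * X ^ (m + 1)) := by
    have h := congrArg (fun z => aeval a (u * X ^ (m + 1)) * z) hone
    simpa only [mul_add, hPQ, add_zero, mul_one] using h
  refine ⟨aeval a (u * X ^ (m + 1)), aeval a (v * g),
    aeval a (u * X ^ m) * aeval a (u * X ^ (m + 1)), hone, hPQ, ?_, ?_, ?_, ?_, ?_, ?_, ?_⟩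
  · rw [(hcomm _ _).eq, hPQ]
  · have e : aeval a (u * X ^ m) * aeval a (u * X ^ (m + 1)) * a =
        aeval a (u * X ^ m * (u * X ^ (m + 1)) * X) := by
      rw [map_mul _ _ X, map_mul _ (u * X ^ m) (u * X ^ (m + 1)), aeval_X]
    rw [e]
    refine Eq.trans ?_ hPP
    rw [← map_mul]
    congr 1; ring
  · rw [mul_assoc, hPP]
  · rw [(hcomm (u * X ^ m) _).eq, ← mul_assoc, hPP]
  · have := hcomm X (v * g)
    rwa [aeval_X] at this
  · have := hcomm X (u * X ^ (m + 1))
    rwa [aeval_X] at this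
  · refine ⟨m + 1, ?_⟩
    have e : aeval a (v * g) * a = aeval a (v * g * X) := by rw [map_mul _ _ X, aeval_X]
    rw [e, ← map_pow, ← h0 (v ^ (m + 1) * g ^ m)]
    congr 1; ring

/-- For `R = (μE - A)⁻¹` and `a = R E` one has `R A = μ a - 1`, so one Fitting decomposition of `a`
splits both matrices. On the range of `P`, `B` inverts `a`; on that of `Q`, `a` is nilpotent and `Z`
inverts `μ a - 1`. -/
theorem IsRegularPencil.exists_weierstrassForm {E A : Matrix (Fin n) (Fin n) 𝕜}
    (h : IsRegularPencil E A) :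
    ∃ S P Q J N : Matrix (Fin n) (Fin n) 𝕜, IsWeierstrassForm E A S P Q J N := by
  obtain ⟨μ, hμ⟩ := h
  have hR : IsUnit (μ • E - A) := (Matrix.isUnit_iff_isUnit_det _).2 hμ.isUnit
  obtain ⟨⟨_, R, -, hRM⟩, rfl⟩ := hR
  change R * (μ • E - A) = 1 at hRM
  have hRu : IsUnit R := IsUnit.of_mul_eq_one _ hRM
  obtain ⟨P, Q, B, h1, hPQ, hQP, hBa, hBP, hPB, haQ, haP, hnil⟩ := exists_drazin (R * E)
  set a := R * E with ha
  have hRA : R * A = μ • a - 1 := by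
    rw [← hRM, mul_sub, mul_smul_comm]; abel
  have hPP : P * P = P := by
    have := congrArg (P * ·) h1
    simpa [mul_add, hPQ] using this
  have hQQ : Q * Q = Q := by
    have := congrArg (Q * ·) h1
    simpa [mul_add, hQP] using this
  have hBQ : B * Q = 0 := by rw [← hBP, mul_assoc, hPQ, mul_zero]
  have hNQ : Q * a * Q = Q * a := by rw [mul_assoc, haQ.eq, ← mul_assoc, hQQ]
  have hQN : Q * (Q * a) = Q * a := by rw [← mul_assoc, hQQ]
  have hu : IsUnit (μ • (Q * a) - 1) := IsNilpotent.isUnit_sub_one (hnil.smul μ)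
  obtain ⟨w, hw⟩ := hu
  have hQw : Commute Q (w : Matrix (Fin n) (Fin n) 𝕜) := by
    rw [hw]
    refine Commute.sub_right (Commute.smul_right ?_ μ) (Commute.one_right _)
    rw [Commute, SemiconjBy, hNQ, hQN]
  have hNw : Commute (Q * a) (w : Matrix (Fin n) (Fin n) 𝕜) := by
    rw [hw]
    exact Commute.sub_right (Commute.smul_right (Commute.refl _) μ) (Commute.one_right _)
  have hQZ : Q * (↑w⁻¹ : Matrix (Fin n) (Fin n) 𝕜) =
      (↑w⁻¹ : Matrix (Fin n) (Fin n) 𝕜) * Q := (hQw.units_inv_right).eq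
  have hNZ : Commute (Q * a) (↑w⁻¹ : Matrix (Fin n) (Fin n) 𝕜) := hNw.units_inv_right
  have hZw : (↑w⁻¹ : Matrix (Fin n) (Fin n) 𝕜) * (μ • (Q * a) - 1) = 1 := by
    rw [← hw, Units.inv_mul]
  set Z : Matrix (Fin n) (Fin n) 𝕜 := ↑w⁻¹
  refine ⟨(B + Z * Q) * R, P, Q, μ • P - B, Z * (Q * a), ⟨?_, ?_, ?_, h1, hPP, hQQ, hPQ, hQP,
    ?_, ?_, ?_, ?_, ?_⟩⟩
  · refine IsUnit.mul (IsUnit.of_mul_eq_one (a * P + Q * (μ • (Q * a) - 1)) ?_) hRu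
    have e1 : B * (a * P) = P := by rw [← mul_assoc, hBa, hPP]
    have e2 : Z * Q * (a * P) = 0 := by
      rw [haP.eq, mul_assoc, ← mul_assoc Q, hQP, zero_mul, mul_zero]
    have e3 : B * (Q * (μ • (Q * a) - 1)) = 0 := by rw [← mul_assoc, hBQ, zero_mul]
    have e4 : Z * Q * (Q * (μ • (Q * a) - 1)) = Q := by
      rw [mul_assoc, ← mul_assoc Q, hQQ, ← mul_assoc, ← hQZ, mul_assoc, hZw, mul_one]
    rw [add_mul, mul_add, mul_add, e1, e2, e3, e4, ← h1]; abel
  · rw [mul_assoc, ← ha, add_mul, hBa, mul_assoc]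
  · have e : Z * Q * (μ • a - 1) = Q := by
      have : Q * (μ • a - 1) = (μ • (Q * a) - 1) * Q := by
        rw [mul_sub, sub_mul, smul_mul_assoc, hNQ, mul_smul_comm, mul_one, one_mul]
      rw [mul_assoc, this, ← mul_assoc, hZw, one_mul]
    rw [mul_assoc, hRA, add_mul, e, mul_sub, mul_smul_comm, hBa, mul_one]
  · rw [mul_sub, mul_smul_comm, hPP, hPB]
  · rw [sub_mul, smul_mul_assoc, hPP, hBP]
  · rw [← mul_assoc, hQZ, mul_assoc, hQN]
  · rw [mul_assoc, hNQ]
  · exact hNZ.symm.isNilpotent_mul_left hnil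

/-! ### Linear differential equations with constant coefficients -/

theorem _root_.HasDerivWithinAt.matrix_mulVec (B : Matrix (Fin n) (Fin n) 𝕜)
    {x : ℝ → Fin n → 𝕜} {x' : Fin n → 𝕜} {s : Set ℝ} {t : ℝ} (h : HasDerivWithinAt x x' s t) :
    HasDerivWithinAt (fun t => B *ᵥ x t) (B *ᵥ x') s t :=
  ((LinearMap.toContinuousLinearMap (B.mulVecLin.restrictScalars ℝ)).hasFDerivAt
    |>.comp_hasDerivWithinAt t h)

theorem _root_.ContDiffOn.matrix_mulVec (B : Matrix (Fin n) (Fin n) 𝕜)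
    {x : ℝ → Fin n → 𝕜} {s : Set ℝ} {m : WithTop ℕ∞} (h : ContDiffOn ℝ m x s) :
    ContDiffOn ℝ m (fun t => B *ᵥ x t) s :=
  (LinearMap.toContinuousLinearMap (B.mulVecLin.restrictScalars ℝ)).contDiff.comp_contDiffOn h

theorem _root_.ContinuousOn.matrix_mulVec_const (B : Matrix (Fin n) (Fin n) 𝕜)
    {x : ℝ → Fin n → 𝕜} {s : Set ℝ} (h : ContinuousOn x s) :
    ContinuousOn (fun t => B *ᵥ x t) s :=
  (LinearMap.toContinuousLinearMap (B.mulVecLin.restrictScalars ℝ)).continuous.comp_continuousOn h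

theorem contDiffOn_one_of_hasDerivWithinAt {F : Type*} [NormedAddCommGroup F] [NormedSpace ℝ F]
    {x x' : ℝ → F} {a b : ℝ} (hab : a < b)
    (h : ∀ t ∈ Icc a b, HasDerivWithinAt x (x' t) (Icc a b) t) (hx' : ContinuousOn x' (Icc a b)) :
    ContDiffOn ℝ 1 x (Icc a b) := by
  rw [contDiffOn_one_iff_derivWithin (uniqueDiffOn_Icc hab)]
  exact ⟨fun t ht => (h t ht).differentiableWithinAt,
    hx'.congr fun t ht => (h t ht).derivWithin (uniqueDiffOn_Icc hab t ht)⟩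

/-- Variation of constants. -/
theorem exists_linear_ode_solution_clm {F : Type*} [NormedAddCommGroup F] [NormedSpace ℝ F]
    [CompleteSpace F] (L : F →L[ℝ] F) {r : ℝ → F} (hrc : Continuous r) (v₀ : F) :
    ∃ v : ℝ → F, v 0 = v₀ ∧ ∀ t, HasDerivAt v (L (v t) + r t) t := by
  have hexp : ∀ t : ℝ, HasDerivAt (fun u : ℝ => NormedSpace.exp (u • L))
      (L * NormedSpace.exp (t • L)) t := fun t => hasDerivAt_exp_smul_const' L t
  have hexpc : Continuous fun u : ℝ => NormedSpace.exp (u • L) :=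
    continuous_iff_continuousAt.2 fun t => (hexp t).continuousAt
  have hgc : Continuous fun s : ℝ => NormedSpace.exp ((-s) • L) (r s) :=
    (hexpc.comp continuous_neg).clm_apply hrc
  refine ⟨fun t => NormedSpace.exp (t • L)
    (v₀ + ∫ s in (0 : ℝ)..t, NormedSpace.exp ((-s) • L) (r s)), by simp, fun t => ?_⟩
  have h1 : HasDerivAt (fun t => v₀ + ∫ s in (0 : ℝ)..t, NormedSpace.exp ((-s) • L) (r s))
      (NormedSpace.exp ((-t) • L) (r t)) t :=
    (hgc.integral_hasStrictDerivAt 0 t).hasDerivAt.const_add v₀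
  have h2 := (hexp t).clm_apply h1
  have h3 : NormedSpace.exp (t • L) (NormedSpace.exp ((-t) • L) (r t)) = r t := by
    have : NormedSpace.exp (t • L) * NormedSpace.exp ((-t) • L) = 1 := by
      let : NormedAlgebra ℚ (F →L[ℝ] F) := NormedAlgebra.restrictScalars ℚ ℝ (F →L[ℝ] F)
      rw [neg_smul]
      exact (NormedSpace.invertibleExp (t • L)).mul_invOf_self
    exact congrArg (fun K : F →L[ℝ] F => K (r t)) this
  rw [h3] at h2
  exact h2

theorem exists_linear_ode_solution (J : Matrix (Fin n) (Fin n) 𝕜) {T : ℝ} (hT : 0 < T)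
    {q : ℝ → Fin n → 𝕜} (hq : ContinuousOn q (Icc 0 T)) (v₀ : Fin n → 𝕜) :
    ∃ v : ℝ → Fin n → 𝕜, v 0 = v₀ ∧
      ∀ t ∈ Icc 0 T, HasDerivWithinAt v (J *ᵥ v t + q t) (Icc 0 T) t := by
  have hrc : Continuous (IccExtend hT.le ((Icc 0 T).domRestrict q)) :=
    (continuousOn_iff_continuous_domRestrict.1 hq).Icc_extend'
  obtain ⟨v, hv0, hv⟩ := exists_linear_ode_solution_clm
    (LinearMap.toContinuousLinearMap (J.mulVecLin.restrictScalars ℝ)) hrc v₀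
  refine ⟨v, hv0, fun t ht => ?_⟩
  have := (hv t).hasDerivWithinAt (s := Icc 0 T)
  rw [IccExtend_of_mem _ _ ht] at this
  exact this

theorem eq_zero_of_linear_ode (J : Matrix (Fin n) (Fin n) 𝕜) {T : ℝ}
    {v : ℝ → Fin n → 𝕜} (hv : ∀ t ∈ Icc 0 T, HasDerivWithinAt v (J *ᵥ v t) (Icc 0 T) t)
    (h0 : v 0 = 0) : ∀ t ∈ Icc 0 T, v t = 0 := by
  set L : (Fin n → 𝕜) →L[ℝ] (Fin n → 𝕜) :=
    LinearMap.toContinuousLinearMap (J.mulVecLin.restrictScalars ℝ) with hL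
  have := ODE_solution_unique (v := fun _ => L) (K := ‖L‖₊) (f := v) (g := fun _ => 0) (a := 0)
    (b := T) (fun _ => L.lipschitz) (fun t ht => (hv t ht).continuousWithinAt)
    (fun t ht => (hv t (Ico_subset_Icc_self ht)).mono_of_mem_nhdsWithin
      (Icc_mem_nhdsGE_of_mem ht)) continuousOn_const
    (fun t _ => by simpa using hasDerivWithinAt_const t (Ici t) (0 : Fin n → 𝕜)) h0
  exact this

/-! ### Nilpotent differential-algebraic equations -/

/-- If `N ^ (m + 1) *ᵥ w` vanishes identically, its derivative does too, and the equation turns `N ^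
(m + 1) *ᵥ w'` into `N ^ m *ᵥ w`. No initial value is needed. -/
theorem eq_zero_of_nilpotent_dae {N : Matrix (Fin n) (Fin n) 𝕜} (hN : IsNilpotent N) {a b : ℝ}
    (hab : a < b) {w w' : ℝ → Fin n → 𝕜}
    (hw : ∀ t ∈ Icc a b, HasDerivWithinAt w (w' t) (Icc a b) t)
    (h : ∀ t ∈ Icc a b, N *ᵥ w' t = w t) : ∀ t ∈ Icc a b, w t = 0 := by
  obtain ⟨k, hk⟩ := hN
  have key : ∀ j ≤ k, ∀ t ∈ Icc a b, (N ^ (k - j)) *ᵥ w t = 0 := by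
    intro j
    induction j with
    | zero => intro _ t _; simp [hk]
    | succ j ih =>
      intro hj t ht
      have h1 := (hw t ht).matrix_mulVec (N ^ (k - j))
      have h2 : HasDerivWithinAt (fun t => (N ^ (k - j)) *ᵥ w t) 0 (Icc a b) t :=
        (hasDerivWithinAt_const t _ (0 : Fin n → 𝕜)).congr (fun s hs => ih (by omega) s hs)
          (ih (by omega) t ht)
      have h3 := (uniqueDiffOn_Icc hab t ht).eq_deriv _ h1 h2
      rw [show k - j = (k - (j + 1)) + 1 by omega, pow_succ, ← Matrix.mulVec_mulVec, h t ht] at h3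
      exact h3
  intro t ht
  simpa using key k le_rfl t ht

/-- If `u` solves the problem for `g'`, then `N u - g` solves it for `g`, with one more power of `N`
on the residual `r`. Each derivative of `g` is thus traded for a power of `N`. -/
theorem exists_nilpotent_dae_solution_aux (N : Matrix (Fin n) (Fin n) 𝕜) {a b : ℝ} (hab : a < b)
    (k : ℕ) : ∀ g : ℝ → Fin n → 𝕜, ContDiffOn ℝ k g (Icc a b) →
      ∃ w r : ℝ → Fin n → 𝕜, ContDiffOn ℝ 1 w (Icc a b) ∧
        ∀ t ∈ Icc a b, N *ᵥ derivWithin w (Icc a b) t = w t + g t - (N ^ k) *ᵥ r t := by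
  induction k with
  | zero => exact fun g _ => ⟨0, g, contDiffOn_const, fun t _ => by simp⟩
  | succ k ih =>
    intro g hg
    have hU := uniqueDiffOn_Icc hab
    have hg1 : ContDiffOn ℝ 1 g (Icc a b) := hg.of_le (by
      exact_mod_cast Nat.le_add_left 1 k)
    have hg' : ContDiffOn ℝ k (derivWithin g (Icc a b)) (Icc a b) := by
      have := (contDiffOn_succ_iff_derivWithin (n := (k : WithTop ℕ∞)) hU).1
        (by exact_mod_cast hg)
      exact this.2.2
    obtain ⟨u, r, hu, hur⟩ := ih _ hg'
    refine ⟨fun t => N *ᵥ u t - g t, r, (hu.matrix_mulVec N).sub hg1, fun t ht => ?_⟩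
    have hd := (((hu.differentiableOn one_ne_zero t ht).hasDerivWithinAt).matrix_mulVec N).sub
      (hg1.differentiableOn one_ne_zero t ht).hasDerivWithinAt
    have hd' : derivWithin (fun t => N *ᵥ u t - g t) (Icc a b) t = _ := hd.derivWithin (hU t ht)
    rw [hd', hur t ht, pow_succ', ← Matrix.mulVec_mulVec]
    simp only [Matrix.mulVec_sub, Matrix.mulVec_add]
    abel

theorem exists_nilpotent_dae_solution {N : Matrix (Fin n) (Fin n) 𝕜} {k : ℕ} (hN : N ^ k = 0)
    {a b : ℝ} (hab : a < b) {g : ℝ → Fin n → 𝕜} (hg : ContDiffOn ℝ k g (Icc a b)) :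
    ∃ w : ℝ → Fin n → 𝕜, ContDiffOn ℝ 1 w (Icc a b) ∧
      ∀ t ∈ Icc a b, N *ᵥ derivWithin w (Icc a b) t = w t + g t := by
  obtain ⟨w, r, hw, h⟩ := exists_nilpotent_dae_solution_aux N hab k g hg
  exact ⟨w, hw, fun t ht => by simpa [hN] using h t ht⟩

/-! ### Decoupling into differential and algebraic parts -/

section Decoupling

variable {E A S P Q J N : Matrix (Fin n) (Fin n) 𝕜}

theorem IsWeierstrassForm.equation_iff (hW : IsWeierstrassForm E A S P Q J N)
    (x x' q : Fin n → 𝕜) :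
    E *ᵥ x' = A *ᵥ x + q ↔
      P *ᵥ x' = J *ᵥ x + P *ᵥ S *ᵥ q ∧ N *ᵥ x' = Q *ᵥ x + Q *ᵥ S *ᵥ q := by
  have hS : E *ᵥ x' = A *ᵥ x + q ↔ P *ᵥ x' + N *ᵥ x' = J *ᵥ x + Q *ᵥ x + S *ᵥ q := by
    rw [← Matrix.add_mulVec, ← Matrix.add_mulVec, ← hW.mul_left, ← hW.mul_right,
      ← Matrix.mulVec_mulVec, ← Matrix.mulVec_mulVec, ← Matrix.mulVec_add]
    exact ((Matrix.mulVec_injective_of_isUnit hW.isUnit).eq_iff).symm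
  have hPN : P * N = 0 := by rw [← hW.Q_mul_N, ← mul_assoc, hW.P_mul_Q, zero_mul]
  have hQJ : Q * J = 0 := by rw [← hW.P_mul_J, ← mul_assoc, hW.Q_mul_P, zero_mul]
  rw [hS]
  refine ⟨fun h => ⟨?_, ?_⟩, fun ⟨h1, h2⟩ => ?_⟩
  · have := congrArg (P *ᵥ ·) h
    simpa [Matrix.mulVec_add, hW.P_mul_P, hPN, hW.P_mul_J, hW.P_mul_Q] using this
  · have := congrArg (Q *ᵥ ·) h
    simpa [Matrix.mulVec_add, hW.Q_mul_Q, hW.Q_mul_P, hQJ, hW.Q_mul_N] using this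
  · have : S *ᵥ q = P *ᵥ S *ᵥ q + Q *ᵥ S *ᵥ q := by
      rw [← Matrix.add_mulVec, hW.add_eq_one, Matrix.one_mulVec]
    rw [h1, h2]
    nth_rewrite 3 [this]
    abel

theorem IsDAESolution.hasDerivWithinAt {T : ℝ} {q x : ℝ → Fin n → 𝕜}
    (hx : IsDAESolution E A T q x) {t : ℝ} (ht : t ∈ Icc 0 T) :
    HasDerivWithinAt x (derivWithin x (Icc 0 T) t) (Icc 0 T) t :=
  (hx.1.differentiableOn one_ne_zero t ht).hasDerivWithinAt

/-- A solution of the nilpotent part extends to a solution of the full equation, with an arbitrary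
initial value of the finite part. -/
theorem IsWeierstrassForm.exists_solution (hW : IsWeierstrassForm E A S P Q J N) {T : ℝ}
    (hT : 0 < T) {q w : ℝ → Fin n → 𝕜} (hq : ContinuousOn q (Icc 0 T))
    (hw : ContDiffOn ℝ 1 w (Icc 0 T))
    (hNw : ∀ t ∈ Icc 0 T, N *ᵥ derivWithin w (Icc 0 T) t = w t + Q *ᵥ S *ᵥ q t)
    (v₀ : Fin n → 𝕜) :
    ∃ x, IsDAESolution E A T q x ∧ x 0 = P *ᵥ v₀ + w 0 := by
  have hU := uniqueDiffOn_Icc hT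
  -- The equation itself places `w` in the range of `Q`, as `Q * N = N`.
  have hQw : ∀ t ∈ Icc 0 T, Q *ᵥ w t = w t := fun t ht => by
    have h1 : w t = N *ᵥ derivWithin w (Icc 0 T) t - Q *ᵥ S *ᵥ q t := by rw [hNw t ht]; abel
    rw [h1, Matrix.mulVec_sub, Matrix.mulVec_mulVec, Matrix.mulVec_mulVec, hW.Q_mul_N, hW.Q_mul_Q]
  obtain ⟨v, hv0, hv⟩ := exists_linear_ode_solution J hT
    ((hq.matrix_mulVec_const S).matrix_mulVec_const P) v₀
  have hvc : ContinuousOn v (Icc 0 T) := fun t ht => (hv t ht).continuousWithinAt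
  have hv1 : ContDiffOn ℝ 1 v (Icc 0 T) := contDiffOn_one_of_hasDerivWithinAt hT hv
    ((hvc.matrix_mulVec_const J).add ((hq.matrix_mulVec_const S).matrix_mulVec_const P))
  have hJQ : J * Q = 0 := by rw [← hW.J_mul_P, mul_assoc, hW.P_mul_Q, mul_zero]
  have hNP : N * P = 0 := by rw [← hW.N_mul_Q, mul_assoc, hW.Q_mul_P, mul_zero]
  refine ⟨fun t => P *ᵥ v t + Q *ᵥ w t, ⟨(hv1.matrix_mulVec P).add (hw.matrix_mulVec Q),
    fun t ht => ?_⟩, ?_⟩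
  · have hd : derivWithin (fun t => P *ᵥ v t + Q *ᵥ w t) (Icc 0 T) t = _ :=
      (((hv t ht).matrix_mulVec P).add
      ((hw.differentiableOn one_ne_zero t ht).hasDerivWithinAt.matrix_mulVec Q)).derivWithin
        (hU t ht)
    rw [hd, hW.equation_iff]
    constructor
    · simp [Matrix.mulVec_add, hW.P_mul_P, hW.P_mul_Q, hW.P_mul_J, hW.J_mul_P, hJQ,
        ← mul_assoc]
    · have := hNw t ht
      simp only [Matrix.mulVec_mulVec] at this
      simpa [Matrix.mulVec_add, hNP, hW.N_mul_Q, hW.Q_mul_P, hW.Q_mul_Q, this, ← mul_assoc]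
        using (hQw t ht).symm
  · simp only [hv0, hQw 0 (left_mem_Icc.2 hT.le)]

/-- The `P` part of the difference solves a linear ODE with zero initial value, the `Q` part a
homogeneous nilpotent equation. -/
theorem IsWeierstrassForm.solution_unique (hW : IsWeierstrassForm E A S P Q J N) {T : ℝ}
    (hT : 0 < T) {q x y : ℝ → Fin n → 𝕜} (hx : IsDAESolution E A T q x)
    (hy : IsDAESolution E A T q y) (h0 : x 0 = y 0) : ∀ t ∈ Icc 0 T, x t = y t := by
  have hd : ∀ t ∈ Icc 0 T, HasDerivWithinAt (fun t => x t - y t)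
      (derivWithin x (Icc 0 T) t - derivWithin y (Icc 0 T) t) (Icc 0 T) t :=
    fun t ht => (hx.hasDerivWithinAt ht).sub (hy.hasDerivWithinAt ht)
  have he : ∀ t ∈ Icc 0 T, _ := fun t ht => (hW.equation_iff (x t - y t)
      (derivWithin x (Icc 0 T) t - derivWithin y (Icc 0 T) t) 0).1 (by
    rw [Matrix.mulVec_sub, hx.2 t ht, hy.2 t ht, Matrix.mulVec_sub]; abel)
  simp only [Matrix.mulVec_zero, add_zero] at he
  have h1 := eq_zero_of_linear_ode (v := fun t => P *ᵥ (x t - y t)) J (T := T)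
    (fun t ht => by
      have := (hd t ht).matrix_mulVec P
      rwa [(he t ht).1, ← hW.J_mul_P, ← Matrix.mulVec_mulVec] at this) (by simp [h0])
  have h2 := eq_zero_of_nilpotent_dae hW.isNilpotent hT (w := fun t => Q *ᵥ (x t - y t))
    (fun t ht => (hd t ht).matrix_mulVec Q) (fun t ht => by
      rw [Matrix.mulVec_mulVec, hW.N_mul_Q, (he t ht).2])
  intro t ht
  have h3 : (P + Q) *ᵥ (x t - y t) = 0 := by
    rw [Matrix.add_mulVec, h1 t ht, h2 t ht, add_zero]
  rwa [hW.add_eq_one, Matrix.one_mulVec, sub_eq_zero] at h3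

/-- The algebraic part of a solution is determined by the inhomogeneity. -/
theorem IsWeierstrassForm.algebraic_part_eq (hW : IsWeierstrassForm E A S P Q J N) {T : ℝ}
    (hT : 0 < T) {q x w : ℝ → Fin n → 𝕜} (hx : IsDAESolution E A T q x)
    (hw : ContDiffOn ℝ 1 w (Icc 0 T))
    (hNw : ∀ t ∈ Icc 0 T, N *ᵥ derivWithin w (Icc 0 T) t = w t + Q *ᵥ S *ᵥ q t) :
    ∀ t ∈ Icc 0 T, Q *ᵥ x t = w t := by
  have h2 := eq_zero_of_nilpotent_dae hW.isNilpotent hT (w := fun t => Q *ᵥ x t - w t)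
    (w' := fun t => Q *ᵥ derivWithin x (Icc 0 T) t - derivWithin w (Icc 0 T) t)
    (fun t ht => ((hx.hasDerivWithinAt ht).matrix_mulVec Q).sub
      (hw.differentiableOn one_ne_zero t ht).hasDerivWithinAt) (fun t ht => by
      rw [Matrix.mulVec_sub, Matrix.mulVec_mulVec, hW.N_mul_Q, hNw t ht,
        ((hW.equation_iff _ _ _).1 (hx.2 t ht)).2]
      abel)
  exact fun t ht => sub_eq_zero.1 (h2 t ht)

end Decoupling

/-! ### Levels and step sequences -/

section Levels

variable {E A D : Matrix (Fin n) (Fin n) 𝕜} {τ : ℝ} {f φ : ℝ → Fin n → 𝕜} {i : ℕ}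
  {x : ℕ → ℝ → Fin n → 𝕜}

theorem IsStepSequence.update (hx : IsStepSequence E A D τ f φ i x) {y : ℝ → Fin n → 𝕜}
    (hy : IsDAESolution E A τ (fun t => D *ᵥ x i t + f (t + i * τ)) y) (hy0 : y 0 = x i τ) :
    IsStepSequence E A D τ f φ (i + 1) (Function.update x (i + 1) y) := by
  refine ⟨fun t ht => ?_, fun k hk => ?_⟩
  · rw [Function.update_of_ne (Nat.succ_ne_zero i).symm]
    exact hx.1 t ht
  · rw [Function.update_of_ne (show k ≠ i + 1 by omega)]
    rcases Nat.lt_succ_iff_lt_or_eq.1 hk with h | rfl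
    · rw [Function.update_of_ne (show k + 1 ≠ i + 1 by omega)]
      exact hx.2 k h
    · rw [Function.update_self]
      exact ⟨hy, hy0⟩

theorem isStepSequence_zero : IsStepSequence E A D τ f φ 0 (fun _ t => φ (t - τ)) :=
  ⟨fun _ _ => rfl, fun k hk => absurd hk (Nat.not_lt_zero k)⟩

theorem IsAdmissible.exists_isStepSequence_one (h : IsAdmissible E A D τ f φ) :
    ∃ x, IsStepSequence E A D τ f φ 1 x := by
  obtain ⟨y, hy, hy0⟩ := h
  exact ⟨_, isStepSequence_zero.update (y := y) (by simpa using hy) (by simpa using hy0)⟩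

/-- Continuity at the junction is built into the steps, so existence alone puts the level at `0` or
above. -/
theorem IsStepSequence.zero_mem_matchingOrders (hi : 1 ≤ i)
    (hx : IsStepSequence E A D τ f φ i x) : 0 ∈ matchingOrders E A D τ f φ i := by
  refine ⟨x, hx, fun k hk => ?_⟩
  obtain rfl := Nat.le_zero.1 hk
  obtain ⟨j, rfl⟩ : ∃ j, i = j + 1 := ⟨i - 1, by omega⟩
  simpa [iteratedDerivWithin_zero] using (hx.2 j (Nat.lt_succ_self j)).2

theorem zero_le_dataLevel (hi : 1 ≤ i) (hx : IsStepSequence E A D τ f φ i x) :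
    0 ≤ dataLevel E A D τ f φ i :=
  le_sSup ⟨0, hx.zero_mem_matchingOrders hi, rfl⟩

end Levels

/-! ### The case `N S D = 0` -/

section NonAdvanced

variable {E A D S P Q J N : Matrix (Fin n) (Fin n) 𝕜}

theorem IsWeierstrassForm.exists_algebraic_part (hW : IsWeierstrassForm E A S P Q J N) {a b : ℝ}
    (hab : a < b) {f : ℝ → Fin n → 𝕜} (hf : ContDiffOn ℝ ∞ f (Icc a b)) :
    ∃ h : ℝ → Fin n → 𝕜, ContDiffOn ℝ 1 h (Icc a b) ∧
      ∀ t ∈ Icc a b, N *ᵥ derivWithin h (Icc a b) t = h t + Q *ᵥ S *ᵥ f t := by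
  obtain ⟨k, hk⟩ := hW.isNilpotent
  exact exists_nilpotent_dae_solution hk hab
    (((hf.of_le (by exact_mod_cast le_top)).matrix_mulVec S).matrix_mulVec Q)

/-- If `N S D = 0`, a `C¹` parameter changes the algebraic part without being differentiated. -/
theorem IsWeierstrassForm.algebraic_part_add (hW : IsWeierstrassForm E A S P Q J N)
    (hD : N * S * D = 0) {a b : ℝ} (hab : a < b) {f h lam : ℝ → Fin n → 𝕜}
    (hh : ContDiffOn ℝ 1 h (Icc a b))
    (hNh : ∀ t ∈ Icc a b, N *ᵥ derivWithin h (Icc a b) t = h t + Q *ᵥ S *ᵥ f t)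
    (hlam : ContDiffOn ℝ 1 lam (Icc a b)) :
    ContDiffOn ℝ 1 (fun t => h t - Q *ᵥ S *ᵥ D *ᵥ lam t) (Icc a b) ∧
      ∀ t ∈ Icc a b, N *ᵥ derivWithin (fun t => h t - Q *ᵥ S *ᵥ D *ᵥ lam t) (Icc a b) t =
        (h t - Q *ᵥ S *ᵥ D *ᵥ lam t) + Q *ᵥ S *ᵥ (D *ᵥ lam t + f t) := by
  refine ⟨hh.sub (((hlam.matrix_mulVec D).matrix_mulVec S).matrix_mulVec Q), fun t ht => ?_⟩
  have hd : derivWithin (fun t => h t - Q *ᵥ S *ᵥ D *ᵥ lam t) (Icc a b) t = _ :=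
    ((hh.differentiableOn one_ne_zero t ht).hasDerivWithinAt.sub
      ((((hlam.differentiableOn one_ne_zero t ht).hasDerivWithinAt.matrix_mulVec D).matrix_mulVec
        S).matrix_mulVec Q)).derivWithin (uniqueDiffOn_Icc hab t ht)
  have h0 : N * Q * S * D = 0 := by rw [hW.N_mul_Q, hD]
  rw [hd, Matrix.mulVec_sub, hNh t ht]
  simp only [Matrix.mulVec_mulVec, Matrix.mulVec_add, ← mul_assoc, h0, Matrix.zero_mulVec]
  abel

theorem IsWeierstrassForm.smoothnessSuffices_one (hW : IsWeierstrassForm E A S P Q J N)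
    (hD : N * S * D = 0) {T : ℝ} (hT : 0 < T) {f : ℝ → Fin n → 𝕜}
    (hf : ContDiffOn ℝ ∞ f (Icc 0 T)) : SmoothnessSuffices E A D T f 1 := by
  intro lam hlam
  have hlam1 : ContDiffOn ℝ 1 lam (Icc 0 T) := by exact_mod_cast hlam
  obtain ⟨h, hh, hNh⟩ := hW.exists_algebraic_part hT hf
  obtain ⟨hw, hNw⟩ := hW.algebraic_part_add hD hT hh hNh hlam1
  obtain ⟨x, hx, -⟩ := hW.exists_solution hT (q := fun t => D *ᵥ lam t + f t)
    ((hlam1.continuousOn.matrix_mulVec_const D).add hf.continuousOn) hw hNw 0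
  exact ⟨x 0, x, hx, rfl⟩

theorem add_mul_mem_Icc {τ t : ℝ} (hτ : 0 < τ) {k M : ℕ} (hk : k < M) (ht : t ∈ Icc 0 τ) :
    t + k * τ ∈ Icc 0 (M * τ) := by
  have h1 : (k : ℝ) + 1 ≤ M := by exact_mod_cast hk
  have h2 := mul_le_mul_of_nonneg_right h1 hτ.le
  have h3 : 0 ≤ (k : ℝ) * τ := by positivity
  exact ⟨add_nonneg ht.1 h3, by linarith [ht.2]⟩

/-- If `N S D = 0`, the method of steps never breaks down. -/
theorem IsWeierstrassForm.exists_isStepSequence (hW : IsWeierstrassForm E A S P Q J N)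
    (hD : N * S * D = 0) {τ : ℝ} (hτ : 0 < τ) {M : ℕ} (hM : 1 ≤ M) {f φ : ℝ → Fin n → 𝕜}
    (hf : ContDiffOn ℝ ∞ f (Icc 0 (M * τ))) (hφ : ContDiffOn ℝ ∞ φ (Icc (-τ) 0))
    (hadm : IsAdmissible E A D τ f φ) :
    ∀ i ≤ M, ∃ x, IsStepSequence E A D τ f φ i x := by
  have hMτ : 0 < (M : ℝ) * τ := by positivity
  obtain ⟨h, hh, hNh⟩ := hW.exists_algebraic_part hMτ hf
  have hshift : ∀ k < M, ContDiffOn ℝ 1 (fun t => h (t + k * τ)) (Icc 0 τ) ∧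
      ∀ t ∈ Icc 0 τ, N *ᵥ derivWithin (fun t => h (t + k * τ)) (Icc 0 τ) t =
        h (t + k * τ) + Q *ᵥ S *ᵥ f (t + k * τ) := by
    intro k hk
    have hmaps : MapsTo (fun t => t + (k : ℝ) * τ) (Icc 0 τ) (Icc 0 (M * τ)) :=
      fun t ht => add_mul_mem_Icc hτ hk ht
    refine ⟨hh.comp (contDiff_id.add contDiff_const).contDiffOn hmaps, fun t ht => ?_⟩
    have hd := ((hh.differentiableOn one_ne_zero _ (hmaps ht)).hasDerivWithinAt.scomp t
      ((hasDerivWithinAt_id t (Icc 0 τ)).add_const ((k : ℝ) * τ)) hmaps)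
    have hd' : derivWithin (fun t => h (t + k * τ)) (Icc 0 τ) t = _ :=
      hd.derivWithin (uniqueDiffOn_Icc hτ t ht)
    rw [hd', one_smul]
    exact hNh _ (hmaps ht)
  have hφ1 : ContDiffOn ℝ 1 (fun t => φ (t - τ)) (Icc 0 τ) :=
    (hφ.of_le (by exact_mod_cast le_top)).comp (contDiff_id.sub contDiff_const).contDiffOn
      fun t ht => ⟨by linarith [ht.1], by linarith [ht.2]⟩
  have hfk : ∀ k < M, ContinuousOn (fun t => f (t + k * τ)) (Icc 0 τ) := fun k hk =>
    hf.continuousOn.comp (by fun_prop) fun t ht => add_mul_mem_Icc hτ hk ht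
  -- The last identity says that `x i τ` is consistent for the next step. A single `h` on all of
  -- `[0, Mτ]` propagates it: the end of one step and the start of the next use the same value of
  -- `h`.
  suffices H : ∀ i ≤ M, ∃ x, IsStepSequence E A D τ f φ i x ∧ ContDiffOn ℝ 1 (x i) (Icc 0 τ) ∧
      Q *ᵥ x i τ = h (i * τ) - Q *ᵥ S *ᵥ D *ᵥ x i 0 from
    fun i hi => (H i hi).imp fun _ hx => hx.1
  intro i
  induction i with
  | zero =>
    intro _
    refine ⟨_, isStepSequence_zero, hφ1, ?_⟩
    -- Admissibility is this consistency condition at the first junction.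
    obtain ⟨y, hy, hy0⟩ := hadm
    obtain ⟨hs, hNs⟩ := hshift 0 (by omega)
    obtain ⟨hw, hNw⟩ := hW.algebraic_part_add hD hτ hs hNs hφ1
    simp only [Nat.cast_zero, zero_mul, add_zero] at hw hNw
    have := hW.algebraic_part_eq hτ hy hw hNw 0 (left_mem_Icc.2 hτ.le)
    simpa [hy0] using this
  | succ i ih =>
    intro hi
    obtain ⟨x, hx, hx1, hxτ⟩ := ih (by omega)
    obtain ⟨hs, hNs⟩ := hshift i (by omega)
    obtain ⟨hw, hNw⟩ := hW.algebraic_part_add hD hτ hs hNs hx1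
    obtain ⟨y, hy, hy0⟩ := hW.exists_solution hτ (q := fun t => D *ᵥ x i t + f (t + i * τ))
      ((hx1.continuousOn.matrix_mulVec_const D).add (hfk i (by omega))) hw hNw (x i τ)
    have hy0' : y 0 = x i τ := by
      rw [hy0, zero_add, ← hxτ, ← Matrix.add_mulVec, hW.add_eq_one, Matrix.one_mulVec]
    refine ⟨_, hx.update hy hy0', ?_, ?_⟩
    · simpa using hy.1
    · have := hW.algebraic_part_eq hτ hy hw hNw τ (right_mem_Icc.2 hτ.le)
      rw [Function.update_self, hy0', this]
      congr 2
      push_cast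
      ring

theorem IsWeierstrassForm.not_isDeSmoothing (hW : IsWeierstrassForm E A S P Q J N)
    (hD : N * S * D = 0) {τ : ℝ} (hτ : 0 < τ) {M : ℕ} (hM : 1 ≤ M) :
    ¬ IsDeSmoothing E A D τ M := by
  rintro ⟨j, hj1, hjM, hlevel, -⟩
  have : 0 ≤ level E A D τ M j := by
    refine le_sInf ?_
    rintro l ⟨f, φ, hf, hφ, hadm, rfl⟩
    obtain ⟨x, hx⟩ := hW.exists_isStepSequence hD hτ hM hf hφ hadm j hjM
    exact zero_le_dataLevel hj1.le hx
  rw [hlevel] at this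
  exact absurd (le_bot_iff.1 this) (WithBot.coe_ne_bot (a := (0 : ℕ∞)))

end NonAdvanced

/-! ### The case `N S D ≠ 0` -/

section Advanced

variable {E A D S P Q J N : Matrix (Fin n) (Fin n) 𝕜}

theorem not_differentiableAt_abs_sub_smul {F : Type*} [NormedAddCommGroup F] [NormedSpace ℝ F]
    {v : F} (hv : v ≠ 0) (s : ℝ) : ¬ DifferentiableAt ℝ (fun t : ℝ => |t - s| • v) s := by
  intro h
  obtain ⟨ψ, hψ⟩ := SeparatingDual.exists_ne_zero (R := ℝ) hv
  have h1 : DifferentiableAt ℝ (fun t : ℝ => |t - s|) s := by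
    have := (ψ.differentiableAt.comp s h).mul_const (ψ v)⁻¹
    refine this.congr_of_eventuallyEq (Filter.Eventually.of_forall fun t => ?_)
    simp [mul_inv_cancel_right₀ hψ]
  refine not_differentiableAt_abs_zero ?_
  have h2 : DifferentiableAt ℝ (fun t : ℝ => t + s) 0 := by fun_prop
  have h3 := DifferentiableAt.comp (g := fun t : ℝ => |t - s|) (f := fun t : ℝ => t + s) 0
    (by simpa using h1) h2
  simpa [Function.comp_def] using h3

theorem exists_contDiff_one_deriv_abs (s : ℝ) :
    ∃ g : ℝ → ℝ, ContDiff ℝ 1 g ∧ ∀ t, HasDerivAt g |t - s| t := by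
  have hc : Continuous fun t : ℝ => |t - s| := by fun_prop
  have hg : ∀ t, HasDerivAt (fun t => ∫ u in (0 : ℝ)..t, |u - s|) |t - s| t :=
    fun t => (hc.integral_hasStrictDerivAt 0 t).hasDerivAt
  refine ⟨_, contDiff_one_iff_deriv.2 ⟨fun t => (hg t).differentiableAt, ?_⟩, hg⟩
  rwa [show deriv (fun t => ∫ u in (0 : ℝ)..t, |u - s|) = _ from funext fun t => (hg t).deriv]

/-- The equation `N z' = z + g e` with `N² e = 0 ≠ N e` differentiates `g` once. -/
theorem not_solvable_nilpotent_dae {N : Matrix (Fin n) (Fin n) 𝕜} (hN : IsNilpotent N)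
    {e : Fin n → 𝕜} (he : N *ᵥ e ≠ 0) (he2 : N *ᵥ N *ᵥ e = 0) {T : ℝ} (hT : 0 < T)
    {g : ℝ → ℝ} (hg : ∀ t, HasDerivAt g |t - T / 2| t) {z z' : ℝ → Fin n → 𝕜}
    (hz : ∀ t ∈ Icc 0 T, HasDerivWithinAt z (z' t) (Icc 0 T) t)
    (h : ∀ t ∈ Icc 0 T, N *ᵥ z' t = z t + g t • e) : False := by
  -- `N² z` solves the homogeneous equation, hence vanishes; so `N z = -g N e` and `N z' = -|t -
  -- T/2| N e`. But `N z' = z + g e` is differentiable at `T/2`.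
  have hU := uniqueDiffOn_Icc hT
  have h1 := eq_zero_of_nilpotent_dae hN hT (w := fun t => N *ᵥ N *ᵥ z t)
    (fun t ht => ((hz t ht).matrix_mulVec N).matrix_mulVec N) (fun t ht => by
      rw [h t ht]; simp [Matrix.mulVec_add, Matrix.mulVec_smul, he2])
  have h2 : ∀ t ∈ Icc 0 T, N *ᵥ N *ᵥ z' t = 0 := fun t ht =>
    (hU t ht).eq_deriv _ (((hz t ht).matrix_mulVec N).matrix_mulVec N)
      ((hasDerivWithinAt_const t _ (0 : Fin n → 𝕜)).congr h1 (h1 t ht))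
  have h3 : ∀ t ∈ Icc 0 T, N *ᵥ z t = -(g t • N *ᵥ e) := fun t ht => by
    have := h2 t ht
    rw [h t ht, Matrix.mulVec_add, Matrix.mulVec_smul] at this
    exact eq_neg_of_add_eq_zero_left this
  have h4 : ∀ t ∈ Icc 0 T, N *ᵥ z' t = -(|t - T / 2| • N *ᵥ e) := fun t ht =>
    (hU t ht).eq_deriv _ ((hz t ht).matrix_mulVec N)
      ((((hg t).smul_const (N *ᵥ e)).neg.hasDerivWithinAt).congr h3 (h3 t ht))
  have hmem : Icc 0 T ∈ nhds (T / 2) := Icc_mem_nhds (by linarith) (by linarith)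
  have hT2 : T / 2 ∈ Icc 0 T := mem_of_mem_nhds hmem
  refine not_differentiableAt_abs_sub_smul he (T / 2) ?_
  have h5 : DifferentiableAt ℝ (fun t => -(z t + g t • e)) (T / 2) :=
    (((hz _ hT2).hasDerivAt hmem).differentiableAt.add
      ((hg _).differentiableAt.smul_const e)).neg
  refine h5.congr_of_eventuallyEq ?_
  filter_upwards [hmem] with t ht
  rw [← h t ht, h4 t ht, neg_neg]

theorem exists_mulVec_ne_zero (hD : N * S * D ≠ 0) :
    ∃ c : Fin n → 𝕜, N *ᵥ S *ᵥ D *ᵥ c ≠ 0 := by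
  by_contra! h
  refine hD (Matrix.mulVec_injective (funext fun c => ?_))
  simpa [mul_assoc] using h c

/-- Moving along the chain of `d` to its last two nonzero vectors reduces any nilpotency index to
the case `N² e = 0 ≠ N e`. -/
theorem exists_pow_mulVec_of_isNilpotent (hN : IsNilpotent N) {d : Fin n → 𝕜} (hd : N *ᵥ d ≠ 0) :
    ∃ m : ℕ, N *ᵥ (N ^ m) *ᵥ d ≠ 0 ∧ N *ᵥ N *ᵥ (N ^ m) *ᵥ d = 0 := by
  classical
  obtain ⟨k, hk⟩ := hN
  have hex : ∃ m, N *ᵥ (N ^ m) *ᵥ d = 0 := ⟨k, by simp [hk]⟩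
  obtain ⟨m, hm⟩ : ∃ m, Nat.find hex = m + 1 := Nat.exists_eq_succ_of_ne_zero fun h => by
    have := Nat.find_spec hex
    rw [h] at this
    exact hd (by simpa using this)
  refine ⟨m, Nat.find_min hex (by omega), ?_⟩
  have := Nat.find_spec hex
  rw [hm, pow_succ', ← Matrix.mulVec_mulVec] at this
  exact this

theorem IsWeierstrassForm.not_smoothnessSuffices_one (hW : IsWeierstrassForm E A S P Q J N)
    (hD : N * S * D ≠ 0) {T : ℝ} (hT : 0 < T) {f : ℝ → Fin n → 𝕜}
    (hf : ContDiffOn ℝ ∞ f (Icc 0 T)) : ¬ SmoothnessSuffices E A D T f 1 := by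
  intro hsuff
  obtain ⟨c, hc⟩ := exists_mulVec_ne_zero hD
  obtain ⟨g, hg1, hg⟩ := exists_contDiff_one_deriv_abs (T / 2)
  obtain ⟨_, x, hx, -⟩ := hsuff (fun t => g t • c)
    (by
      rw [Nat.cast_one]
      exact (hg1.smul contDiff_const).contDiffOn)
  obtain ⟨h, hh, hNh⟩ := hW.exists_algebraic_part hT hf
  have hd : N *ᵥ Q *ᵥ S *ᵥ D *ᵥ c ≠ 0 := by
    rwa [Matrix.mulVec_mulVec _ N Q, hW.N_mul_Q]
  obtain ⟨m, hm, hm2⟩ := exists_pow_mulVec_of_isNilpotent hW.isNilpotent hd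
  -- Subtracting `h` removes `f`, and `N ^ m` leaves the inhomogeneity `g • e` with `e = N ^ m Q S D
  -- c`.
  refine not_solvable_nilpotent_dae hW.isNilpotent hm hm2 hT hg
    (z := fun t => (N ^ m) *ᵥ (Q *ᵥ x t - h t))
    (fun t ht => (((hx.hasDerivWithinAt ht).matrix_mulVec Q).sub
      (hh.differentiableOn one_ne_zero t ht).hasDerivWithinAt).matrix_mulVec (N ^ m))
    (fun t ht => ?_)
  have e1 := ((hW.equation_iff _ _ _).1 (hx.2 t ht)).2
  beta_reduce at e1 ⊢
  rw [Matrix.mulVec_mulVec, ← pow_succ', pow_succ, ← Matrix.mulVec_mulVec, Matrix.mulVec_sub,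
    Matrix.mulVec_mulVec _ N Q, hW.N_mul_Q, e1, hNh t ht, ← Matrix.mulVec_smul (N ^ m),
    ← Matrix.mulVec_add (N ^ m)]
  congr 1
  simp only [Matrix.mulVec_add, Matrix.mulVec_smul]
  abel

theorem SmoothnessSuffices.mono {T : ℝ} {f : ℝ → Fin n → 𝕜} {k l : ℕ} (hkl : k ≤ l)
    (h : SmoothnessSuffices E A D T f k) : SmoothnessSuffices E A D T f l :=
  fun lam hlam => h lam (hlam.of_le (by exact_mod_cast hkl))

theorem IsWeierstrassForm.isAdvanced (hW : IsWeierstrassForm E A S P Q J N)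
    (hD : N * S * D ≠ 0) {T : ℝ} (hT : 0 < T) {f : ℝ → Fin n → 𝕜}
    (hf : ContDiffOn ℝ ∞ f (Icc 0 T)) : IsAdvanced E A D T f := by
  classical
  have hex : ∃ k, SmoothnessSuffices E A D T f k := by
    obtain ⟨k, hk⟩ := hW.isNilpotent
    refine ⟨k, fun lam hlam => ?_⟩
    have hq : ContDiffOn ℝ k (fun t => D *ᵥ lam t + f t) (Icc 0 T) :=
      (hlam.matrix_mulVec D).add (hf.of_le (by exact_mod_cast le_top))
    obtain ⟨w, hw, hNw⟩ := exists_nilpotent_dae_solution hk hT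
      ((hq.matrix_mulVec S).matrix_mulVec Q)
    obtain ⟨x, hx, -⟩ := hW.exists_solution hT hq.continuousOn hw hNw 0
    exact ⟨x 0, x, hx, rfl⟩
  -- By monotonicity, failure at order `1` also excludes order `0`.
  refine ⟨Nat.find hex, ?_, Nat.find_spec hex, fun m hm => Nat.find_min' hex hm⟩
  by_contra! hlt
  exact hW.not_smoothnessSuffices_one hD hT hf
    ((Nat.find_spec hex).mono (Nat.le_of_lt_succ hlt))

/-- If `q(t) = E c - t A c` on `[0, τ]`, then `t ↦ t c` is a solution. -/
theorem isDAESolution_smul {τ : ℝ} (hτ : 0 < τ) (c : Fin n → 𝕜) {q : ℝ → Fin n → 𝕜}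
    (hq : ∀ t ∈ Icc 0 τ, q t = E *ᵥ c - t • A *ᵥ c) :
    IsDAESolution E A τ q (fun t => t • c) := by
  refine ⟨(contDiff_id.smul contDiff_const).contDiffOn, fun t ht => ?_⟩
  have hd : derivWithin (fun t : ℝ => t • c) (Icc 0 τ) t = _ :=
    ((hasDerivWithinAt_id t (Icc 0 τ)).smul_const c).derivWithin (uniqueDiffOn_Icc hτ t ht)
  rw [hd, hq t ht, one_smul, Matrix.mulVec_smul]
  abel

theorem IsWeierstrassForm.isStepSequence_apply_one (hW : IsWeierstrassForm E A S P Q J N)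
    {τ : ℝ} (hτ : 0 < τ) {c : Fin n → 𝕜} {i : ℕ} (hi : 1 ≤ i) {x : ℕ → ℝ → Fin n → 𝕜}
    (hx : IsStepSequence E A D τ (fun t => E *ᵥ c - t • A *ᵥ c) 0 i x) :
    ∀ t ∈ Icc 0 τ, x 1 t = t • c := by
  obtain ⟨h1, h0⟩ := hx.2 0 hi
  refine hW.solution_unique hτ h1 (isDAESolution_smul hτ c fun t ht => ?_) ?_
  · simp [hx.1 t ht]
  · simp only [zero_add] at h0
    rw [h0, hx.1 τ (right_mem_Icc.2 hτ.le)]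
    simp

theorem IsWeierstrassForm.isDeSmoothing (hW : IsWeierstrassForm E A S P Q J N)
    (hD : N * S * D ≠ 0) {τ : ℝ} (hτ : 0 < τ) {M : ℕ} (hM : 2 ≤ M) :
    IsDeSmoothing E A D τ M := by
  obtain ⟨c, hc⟩ := exists_mulVec_ne_zero hD
  set f : ℝ → Fin n → 𝕜 := fun t => E *ᵥ c - t • A *ᵥ c with hf
  have hf1 : ContDiff ℝ ∞ f := contDiff_const.sub (contDiff_id.smul contDiff_const)
  have h0 : (0 : ℝ) ∈ Icc 0 τ := left_mem_Icc.2 hτ.le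
  have hτmem : τ ∈ Icc 0 τ := right_mem_Icc.2 hτ.le
  have hadm : IsAdmissible E A D τ f 0 :=
    ⟨fun t => t • c, isDAESolution_smul hτ c fun t _ => by simp [hf], by simp⟩
  have hdata : ∀ i, level E A D τ M i ≤ dataLevel E A D τ f 0 i := fun i =>
    sInf_le ⟨f, 0, hf1.contDiffOn, contDiffOn_const, hadm, rfl⟩
  refine ⟨2, one_lt_two, hM, ?_, fun i hi1 hi2 => ?_⟩
  · suffices hemp : matchingOrders E A D τ f 0 2 = ∅ by
      have := hdata 2
      rw [dataLevel, hemp, image_empty, sSup_empty] at this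
      exact le_bot_iff.1 this
    refine eq_empty_of_forall_notMem ?_
    rintro l ⟨x, hx, -⟩
    have hx1 := hW.isStepSequence_apply_one hτ one_le_two hx
    obtain ⟨h2, h20⟩ := hx.2 1 one_lt_two
    set d := Q *ᵥ S *ᵥ D *ᵥ c with hd
    -- This is `-(Q S q + N Q S q')` for the affine inhomogeneity `q t = t D c + E c - (t + τ) A c`;
    -- higher derivatives vanish. At `0` it equals `τ Q c - N d`, whereas `x 1 τ = τ c` requires `τ
    -- Q c`.
    have hw : ∀ t, HasDerivAt (fun t : ℝ => (t + τ) • Q *ᵥ c - (t • d + N *ᵥ d))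
        (Q *ᵥ c - d) t := fun t => by
      have := (((hasDerivAt_id t).add_const τ).smul_const (Q *ᵥ c)).sub
        (((hasDerivAt_id t).smul_const d).add_const (N *ᵥ d))
      rw [one_smul, one_smul] at this
      exact this
    have hQE : Q *ᵥ S *ᵥ E *ᵥ c = N *ᵥ c := by
      rw [Matrix.mulVec_mulVec _ S, hW.mul_left, Matrix.mulVec_mulVec, mul_add, hW.Q_mul_P,
        hW.Q_mul_N, zero_add]
    have hQA : Q *ᵥ S *ᵥ A *ᵥ c = Q *ᵥ c := by
      rw [Matrix.mulVec_mulVec _ S, hW.mul_right, Matrix.mulVec_mulVec, mul_add, hW.Q_mul_Q,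
        ← hW.P_mul_J, ← mul_assoc, hW.Q_mul_P, zero_mul, zero_add]
    have key := hW.algebraic_part_eq hτ h2
      (contDiffOn_one_of_hasDerivWithinAt hτ (fun t _ => (hw t).hasDerivWithinAt)
        continuousOn_const) (fun t ht => by
      rw [(hw t).hasDerivWithinAt.derivWithin (uniqueDiffOn_Icc hτ t ht), hx1 t ht]
      simp only [hf, Nat.cast_one, one_mul, Matrix.mulVec_sub, Matrix.mulVec_add,
        Matrix.mulVec_smul, hQE, hQA, ← hd]
      rw [Matrix.mulVec_mulVec, hW.N_mul_Q]
      abel) 0 h0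
    rw [h20, hx1 τ hτmem, Matrix.mulVec_smul] at key
    refine hc ?_
    have hNd : N *ᵥ d = N *ᵥ S *ᵥ D *ᵥ c := by rw [hd, Matrix.mulVec_mulVec, hW.N_mul_Q]
    rw [zero_add, zero_smul, zero_add, eq_comm, sub_eq_self, hNd] at key
    exact key
  · obtain rfl : i = 1 := by omega
    -- Upper bound: for these data the slopes at the first junction are `c ≠ 0` and `0`. Lower
    -- bound: admissibility always provides `x 1`.
    refine le_antisymm ((hdata 1).trans (sSup_le ?_)) (le_sInf ?_)
    · rintro _ ⟨l, ⟨x, hx, hl⟩, rfl⟩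
      rcases Nat.eq_zero_or_pos l with rfl | hl0
      · rfl
      · exfalso
        have hx1 := hW.isStepSequence_apply_one hτ le_rfl hx
        have h1 := hl 1 hl0
        have hd : derivWithin (fun t : ℝ => t • c) (Icc 0 τ) 0 = _ :=
          ((hasDerivWithinAt_id (0 : ℝ) (Icc 0 τ)).smul_const c).derivWithin
            (uniqueDiffOn_Icc hτ 0 h0)
        rw [iteratedDerivWithin_one, iteratedDerivWithin_one, derivWithin_congr hx1 (hx1 0 h0),
          derivWithin_congr (f := fun _ => (0 : Fin n → 𝕜)) (fun t ht => hx.1 t ht) (hx.1 τ hτmem),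
          hd, one_smul, derivWithin_fun_const] at h1
        exact hc (by simp [show c = 0 from h1])
    · rintro _ ⟨f', φ, -, -, hadm', rfl⟩
      obtain ⟨x, hx⟩ := hadm'.exists_isStepSequence_one
      exact zero_le_dataLevel le_rfl hx

end Advanced

end DDAE

theorem mainTheorem7 {𝕜 : Type*} [RCLike 𝕜] {n : ℕ} (E A D : Matrix (Fin n) (Fin n) 𝕜)
    (τ : ℝ) (hτ : 0 < τ) (M : ℕ) (hM : 1 ≤ M) (f : ℝ → Fin n → 𝕜)
    (hf : ContDiffOn ℝ ∞ f (Icc 0 (M * τ))) (hreg : DDAE.IsRegularPencil E A) :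
    (¬ DDAE.IsAdvanced E A D (M * τ) f → ¬ DDAE.IsDeSmoothing E A D τ M) ∧
      (2 ≤ M → DDAE.IsAdvanced E A D (M * τ) f → DDAE.IsDeSmoothing E A D τ M) := by
  obtain ⟨S, P, Q, J, N, hW⟩ := hreg.exists_weierstrassForm
  have hT : 0 < (M : ℝ) * τ := by positivity
  by_cases hD : N * S * D = 0
  · refine ⟨fun _ => hW.not_isDeSmoothing hD hτ hM, fun _ ⟨k, hk, hleast⟩ => ?_⟩
    -- Order `1` suffices here, so the least order cannot reach `2`.
    exact absurd (hk.trans (hleast.2 (hW.smoothnessSuffices_one hD hT hf))) (by norm_num)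
  · exact ⟨fun h => absurd (hW.isAdvanced hD hT hf) h, fun hM2 _ => hW.isDeSmoothing hD hτ hM2⟩
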